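/- Let $\Sigma$ be a closed connected orientable surface of genus $g\ge 2$. The vertices of the curve complex $C(\Sigma)$ are the isotopy classes of essential simple closed curves in $\Sigma$, and two distinct vertices span an edge if they have disjoint representatives; for two sets $A,B$ of vertices, $d(A,B)\in\{0,1,2,\dots,\infty\}$ denotes the least number of edges of a path in $C(\Sigma)$ from a vertex in $A$ to a vertex in $B$ (and $\infty$ if there is none). A pants decomposition $\mathcal P$ of $\Sigma$ is a collection of $3g-3$ pairwise disjoint essential simple closed curves such that every component of $\Sigma\setminus\bigcup\mathcal P$ is a pair of pants (a three-punctured sphere). Let $V_{\mathcal P}$ be the handlebody with boundary $\Sigma=\Sigma\times\{0\}$ obtained from $\Sigma\times[0,1]$ by attaching a 2-handle to $\Sigma\times\{1\}$ along each curve of $\mathcal P$ and then a 3-ball to each resulting boundary sphere, and let $K_{\mathcal P}$ be the set of isotopy classes of essential simple closed curves in $\Sigma$ that bound properly embedded disks in $V_{\mathcal P}$. Let $\mathcal P$ be a pants decomposition of $\Sigma$, let $\gamma$ be an essential simple closed curve in $\Sigma$, let $\tau_\gamma:\Sigma\to\Sigma$ be a Dehn twist about $\gamma$, and suppose that $d(K_{\mathcal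 P},\{[\gamma]\})=d$ for some integer $d\ge 1$. Then for every $k\in\mathbb Z$, $$d\bigl(K_{\mathcal P},K_{\tau_\gamma^k(\mathcal P)}\bigr)\le 2d-2 .$$ -/

import Mathlib

open Set Topology

/-! ### Simple closed curves, isotopy and the curve complex -/

/-- A simple closed curve in `S`, regarded as a subset: the image of an embedded circle. -/
def IsSimpleClosedCurve {S : Type*} [TopologicalSpace S] (c : Set S) : Prop :=
  ∃ f : C(Circle, S), IsEmbedding f ∧ range f = c

/-- An essential simple closed curve: one that is not homotopic to a point. -/
def IsEssentialCurve {S : Type*} [TopologicalSpace S] (c : Set S) : Prop :=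
  ∃ f : C(Circle, S), IsEmbedding f ∧ range f = c ∧ ¬ f.Nullhomotopic

/-- Two homeomorphisms of `S` are isotopic: they are joined by a path of homeomorphisms that is
jointly continuous in time and space. -/
def IsotopicHomeo {S : Type*} [TopologicalSpace S] (f g : S ≃ₜ S) : Prop :=
  ∃ H : unitInterval → (S ≃ₜ S),
    Continuous (fun p : unitInterval × S => H p.1 p.2) ∧ H 0 = f ∧ H 1 = g

/-- Two subsets of `S` are (ambient) isotopic: a homeomorphism of `S` that is isotopic to the
identity carries the one onto the other. -/
def IsotopicSets {S : Type*} [TopologicalSpace S] (c c' : Set S) : Prop :=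
  ∃ h : S ≃ₜ S, IsotopicHomeo (Homeomorph.refl S) h ∧ h '' c = c'

theorem IsotopicSets.refl {S : Type*} [TopologicalSpace S] (c : Set S) : IsotopicSets c c :=
  ⟨Homeomorph.refl S, ⟨fun _ => Homeomorph.refl S, by simpa using continuous_snd, rfl, rfl⟩,
    by simp⟩

theorem IsotopicSets.symm {S : Type*} [TopologicalSpace S] {c c' : Set S}
    (h : IsotopicSets c c') : IsotopicSets c' c := by
  obtain ⟨f, ⟨H, hc, h0, h1⟩, rfl⟩ := h
  refine ⟨f.symm, ⟨fun t => f.symm.trans (H (unitInterval.symm t)), ?_, ?_, ?_⟩, ?_⟩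
  · exact hc.comp (g := fun p : unitInterval × S => H p.1 p.2)
      (f := fun p : unitInterval × S => (unitInterval.symm p.1, f.symm p.2))
      (by fun_prop)
  · ext x; simp [h1]
  · ext x; simp [h0]
  · rw [← image_comp]; simp

theorem IsotopicSets.trans {S : Type*} [TopologicalSpace S] {c c' c'' : Set S}
    (h : IsotopicSets c c') (h' : IsotopicSets c' c'') : IsotopicSets c c'' := by
  obtain ⟨f, ⟨H, hc, h0, h1⟩, rfl⟩ := h
  obtain ⟨g, ⟨K, kc, k0, k1⟩, rfl⟩ := h'
  refine ⟨f.trans g, ⟨fun t => (H t).trans (K t), ?_, ?_, ?_⟩, ?_⟩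
  · exact kc.comp (g := fun p : unitInterval × S => K p.1 p.2)
      (f := fun p : unitInterval × S => (p.1, H p.1 p.2))
      (continuous_fst.prodMk hc)
  · ext x; simp [h0, k0]
  · ext x; simp [h1, k1]
  · rw [← image_comp]; rfl

/-- The essential simple closed curves of `S`. -/
def EssentialCurve (S : Type*) [TopologicalSpace S] : Type _ := {c : Set S // IsEssentialCurve c}

/-- Isotopy of essential simple closed curves. -/
instance curveSetoid (S : Type*) [TopologicalSpace S] : Setoid (EssentialCurve S) where
  r c c' := IsotopicSets c.1 c'.1
  iseqv := ⟨fun c => IsotopicSets.refl c.1, fun h => h.symm, fun h h' => h.trans h'⟩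

/-- The vertices of the curve complex: isotopy classes of essential simple closed curves. -/
def CurveVertex (S : Type*) [TopologicalSpace S] : Type _ := Quotient (curveSetoid S)

/-- The isotopy class of an essential simple closed curve. -/
def EssentialCurve.toVertex {S : Type*} [TopologicalSpace S] (c : EssentialCurve S) :
    CurveVertex S := Quotient.mk (curveSetoid S) c

/-- The 1-skeleton of the curve complex: two distinct isotopy classes span an edge if they have
disjoint representatives. -/
def curveGraph (S : Type*) [TopologicalSpace S] : SimpleGraph (CurveVertex S) where
  Adj v w := v ≠ w ∧ ∃ a b : EssentialCurve S,
    a.toVertex = v ∧ b.toVertex = w ∧ Disjoint a.1 b.1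
  symm := by
    constructor
    rintro v w ⟨hne, a, b, ha, hb, hd⟩
    exact ⟨hne.symm, b, a, hb, ha, hd.symm⟩
  loopless := ⟨fun _ h => h.1 rfl⟩

/-- The distance between two sets of vertices of the curve complex: the least number of edges of a
path from a vertex of the first to a vertex of the second (`⊤` if there is no such path). -/
noncomputable def curveDist {S : Type*} [TopologicalSpace S] (A B : Set (CurveVertex S)) : ℕ∞ :=
  ⨅ u ∈ A, ⨅ v ∈ B, (curveGraph S).edist u v

/-! ### Closed orientable surfaces -/

/-- A surface is orientable if it contains no Möbius band, i.e. there is no continuous map of the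
square that is injective up to exactly the identification `(0, t) ~ (1, 1 - t)`. -/
def IsOrientableSurface (S : Type*) [TopologicalSpace S] : Prop :=
  ¬ ∃ f : C(unitInterval × unitInterval, S), ∀ p q, f p = f q ↔
    p = q ∨ (p.1 = 0 ∧ q.1 = 1 ∧ q.2 = unitInterval.symm p.2) ∨
      (q.1 = 0 ∧ p.1 = 1 ∧ p.2 = unitInterval.symm q.2)

/-- The genus of a closed orientable surface: the largest number of pairwise disjoint simple closed
curves whose union does not disconnect the surface. -/
def HasGenus (S : Type*) [TopologicalSpace S] (g : ℕ) : Prop :=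
  IsGreatest {n : ℕ | ∃ c : Fin n → Set S, (∀ i, IsSimpleClosedCurve (c i)) ∧
    Pairwise (fun i j => Disjoint (c i) (c j)) ∧ IsConnected (⋃ i, c i)ᶜ} g

/-- The unit sphere in `ℝ³`. -/
abbrev UnitSphere : Type := Metric.sphere (0 : EuclideanSpace ℝ (Fin 3)) 1

/-- The closed unit ball in `ℝ³`. -/
abbrev UnitBall : Type := Metric.closedBall (0 : EuclideanSpace ℝ (Fin 3)) 1

/-- The closed unit disk. -/
abbrev UnitDisk : Type := Metric.closedBall (0 : ℂ) 1

/-- The boundary circle of the unit disk. -/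
def UnitDisk.circle : Set UnitDisk := {z | ‖(z : ℂ)‖ = 1}

/-- The inclusion of the circle as the boundary of the unit disk. -/
def UnitDisk.ofCircle (z : Circle) : UnitDisk :=
  ⟨z, mem_closedBall_zero_iff.2 z.norm_coe.le⟩

/-- The inclusion of the sphere as the boundary of the unit ball. -/
def UnitBall.ofSphere (x : UnitSphere) : UnitBall := ⟨x.1, Metric.sphere_subset_closedBall x.2⟩

/-- An `n`-punctured sphere. -/
def IsPuncturedSphere (n : ℕ) (X : Type*) [TopologicalSpace X] : Prop :=
  ∃ F : Finset UnitSphere, F.card = n ∧ Nonempty (X ≃ₜ {x : UnitSphere // x ∉ F})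

/-- A pants decomposition of a surface of genus `g`: a collection of `3g - 3` pairwise disjoint
essential simple closed curves such that each component of the complement of their union is a pair
of pants, i.e. a three-punctured sphere. -/
structure IsPantsDecomposition {S : Type*} [TopologicalSpace S] (g : ℕ)
    (P : Fin (3 * g - 3) → Set S) : Prop where
  essential : ∀ i, IsEssentialCurve (P i)
  disjoint : Pairwise (fun i j => Disjoint (P i) (P j))
  pants : ∀ x ∈ (⋃ i, P i)ᶜ, IsPuncturedSphere 3 (connectedComponentIn (⋃ i, P i)ᶜ x)

/-! ### Annular neighbourhoods and Dehn twists -/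

/-- The annulus `S¹ × [0, 1]`. -/
abbrev Annulus : Type := Circle × unitInterval

/-- The open annulus `S¹ × (0, 1)`. -/
def Annulus.interior : Set Annulus := {a | 0 < a.2 ∧ a.2 < 1}

/-- The core circle `S¹ × {1/2}` of the annulus. -/
def Annulus.core : Set Annulus := {a | (a.2 : ℝ) = 1 / 2}

/-- The twist map `(θ, t) ↦ (θ + 2πt, t)` of the annulus. -/
noncomputable def Annulus.twist : Annulus ≃ₜ Annulus where
  toFun a := (a.1 * Circle.exp (2 * Real.pi * (a.2 : ℝ)), a.2)
  invFun a := (a.1 * (Circle.exp (2 * Real.pi * (a.2 : ℝ)))⁻¹, a.2)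
  left_inv a := by simp
  right_inv a := by simp
  continuous_toFun := by fun_prop
  continuous_invFun := by fun_prop

theorem Annulus.twist_of_not_mem_interior {a : Annulus} (ha : a ∉ Annulus.interior) :
    Annulus.twist a = a := by
  obtain ⟨z, t⟩ := a
  have h : t = 0 ∨ t = 1 := by
    by_contra! h
    exact ha ⟨lt_of_le_of_ne t.2.1 fun e => h.1 e.symm, lt_of_le_of_ne t.2.2 fun e => h.2 e⟩
  rcases h with rfl | rfl <;> simp [Annulus.twist]

/-- A (parametrized) annular neighbourhood of a simple closed curve `c`: an embedded annulus with
core circle `c`. (In a surface the open annulus is automatically open, by invariance of domain.) -/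
structure AnnularNbhd {S : Type*} [TopologicalSpace S] (c : Set S) where
  φ : Annulus → S
  isEmbedding : IsEmbedding φ
  isOpen_interior : IsOpen (φ '' Annulus.interior)
  core : φ '' Annulus.core = c

namespace AnnularNbhd

variable {S : Type*} [TopologicalSpace S] {c : Set S} (N : AnnularNbhd c)

theorem extend_apply (e : Annulus ≃ₜ Annulus) (a : Annulus) :
    Function.extend N.φ (N.φ ∘ e) id (N.φ a) = N.φ (e a) :=
  N.isEmbedding.injective.extend_apply _ _ a

theorem extend_apply_of_not_mem (e : Annulus ≃ₜ Annulus)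
    (he : ∀ a, a ∉ Annulus.interior → e a = a) {x : S} (hx : x ∉ N.φ '' Annulus.interior) :
    Function.extend N.φ (N.φ ∘ e) id x = x := by
  by_cases h : ∃ a, N.φ a = x
  · obtain ⟨a, rfl⟩ := h
    rw [N.extend_apply, he a fun ha => hx ⟨a, ha, rfl⟩]
  · rw [Function.extend_apply' _ _ _ h, id]

theorem continuous_extend [T2Space S] (e : Annulus ≃ₜ Annulus)
    (he : ∀ a, a ∉ Annulus.interior → e a = a) :
    Continuous (Function.extend N.φ (N.φ ∘ e) id) := by
  have h1 : IsClosed (range N.φ) := (isCompact_range N.isEmbedding.continuous).isClosed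
  have h2 : IsClosed (N.φ '' Annulus.interior)ᶜ := N.isOpen_interior.isClosed_compl
  have hu : range N.φ ∪ (N.φ '' Annulus.interior)ᶜ = univ := by
    refine eq_univ_of_forall fun x => ?_
    by_cases hx : x ∈ N.φ '' Annulus.interior
    · exact Or.inl (image_subset_range _ _ hx)
    · exact Or.inr hx
  rw [← continuousOn_univ, ← hu]
  refine ContinuousOn.union_of_isClosed ?_ ?_ h1 h2
  · rw [continuousOn_iff_continuous_domRestrict]
    have : (range N.φ).domRestrict (Function.extend N.φ (N.φ ∘ e) id) =
        N.φ ∘ e ∘ N.isEmbedding.toHomeomorph.symm := by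
      funext x
      obtain ⟨_, a, rfl⟩ := x
      have : N.isEmbedding.toHomeomorph.symm ⟨N.φ a, a, rfl⟩ = a :=
        N.isEmbedding.toHomeomorph.symm_apply_apply a
      simp only [Function.comp_apply, this]
      exact N.extend_apply e a
    rw [this]
    exact N.isEmbedding.continuous.comp (e.continuous.comp (Homeomorph.continuous _))
  · exact continuousOn_id.congr fun x hx => N.extend_apply_of_not_mem e he hx

theorem extend_symm_extend (e : Annulus ≃ₜ Annulus) (x : S) :
    Function.extend N.φ (N.φ ∘ e.symm) id (Function.extend N.φ (N.φ ∘ e) id x) = x := by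
  by_cases h : ∃ a, N.φ a = x
  · obtain ⟨a, rfl⟩ := h
    rw [N.extend_apply, N.extend_apply, e.symm_apply_apply]
  · rw [Function.extend_apply' (N.φ ∘ e) _ _ h, id, Function.extend_apply' _ _ _ h, id]

/-- The Dehn twist with support in an annular neighbourhood `N`: it is `φ ∘ T ∘ φ⁻¹` on `N`, with
`T` the twist map of the annulus, and the identity outside `N`. -/
noncomputable def dehnTwist [T2Space S] : S ≃ₜ S where
  toFun := Function.extend N.φ (N.φ ∘ Annulus.twist) id
  invFun := Function.extend N.φ (N.φ ∘ Annulus.twist.symm) id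
  left_inv := N.extend_symm_extend Annulus.twist
  right_inv := N.extend_symm_extend Annulus.twist.symm
  continuous_toFun := N.continuous_extend _ fun _ ha => Annulus.twist_of_not_mem_interior ha
  continuous_invFun := N.continuous_extend _ fun a ha => by
    rw [Homeomorph.symm_apply_eq, Annulus.twist_of_not_mem_interior ha]

end AnnularNbhd

/-- `τ` is a Dehn twist about `c`: it is isotopic to the twist supported in an annular
neighbourhood of `c`. Both handednesses are covered, since the parametrization of the annular
neighbourhood may preserve or reverse a given orientation of the surface. -/
def IsDehnTwist {S : Type*} [TopologicalSpace S] [T2Space S] (c : Set S) (τ : S ≃ₜ S) : Prop :=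
  ∃ N : AnnularNbhd c, IsotopicHomeo N.dehnTwist τ

/-! ### The handlebody determined by a full set of curves, and its disk set -/

/-- Pairwise disjoint annular neighbourhoods of the curves of a finite family `Z`, along which
2-handles are attached. -/
structure HandleData {S : Type*} [TopologicalSpace S] {n : ℕ} (Z : Fin n → Set S) where
  nbhd : ∀ i, AnnularNbhd (Z i)
  disjoint : Pairwise fun i j => Disjoint (range (nbhd i).φ) (range (nbhd j).φ)

namespace HandleData

variable {S : Type*} [TopologicalSpace S] {n : ℕ} {Z : Fin n → Set S} (D : HandleData Z)

/-- The gluing of the 2-handles `D² × [0, 1]` to `S × [0, 1]`: the attaching region `S¹ × [0, 1]`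
of the `i`-th handle is glued to the `i`-th annulus in `S × {1}`. -/
inductive Rel : (S × unitInterval) ⊕ (Fin n × UnitDisk × unitInterval) →
    (S × unitInterval) ⊕ (Fin n × UnitDisk × unitInterval) → Prop
  | glue (i : Fin n) (z : Circle) (t : unitInterval) :
      Rel (Sum.inr (i, UnitDisk.ofCircle z, t)) (Sum.inl ((D.nbhd i).φ (z, t), 1))

/-- The 3-manifold obtained from `S × [0, 1]` by attaching a 2-handle to `S × {1}` along each of
the curves. -/
def Space : Type _ := Quot D.Rel

instance : TopologicalSpace D.Space := inferInstanceAs (TopologicalSpace (Quot D.Rel))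

/-- The part of the boundary of `D.Space` other than `S × {0}`: what is left of `S × {1}`, together
with the two parallel copies of the core disk on each handle. -/
def outerBoundary : Set D.Space :=
  {y | (∃ x : S, (∀ i, x ∉ (D.nbhd i).φ '' Annulus.interior) ∧
      y = Quot.mk D.Rel (Sum.inl (x, 1))) ∨
    ∃ (i : Fin n) (z : UnitDisk) (t : unitInterval), (t = 0 ∨ t = 1) ∧
      y = Quot.mk D.Rel (Sum.inr (i, z, t))}

end HandleData

/-- The choices in the construction of the handlebody `V_Z`: the 2-handles, and parametrizations
of the spheres which make up the outer boundary, to each of which a 3-ball is attached. -/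
structure HandlebodyData {S : Type*} [TopologicalSpace S] {n : ℕ} (Z : Fin n → Set S) where
  handles : HandleData Z
  numBalls : ℕ
  sphere : Fin numBalls → UnitSphere → handles.Space
  sphere_isEmbedding : ∀ j, IsEmbedding (sphere j)
  sphere_disjoint : Pairwise fun j l => Disjoint (range (sphere j)) (range (sphere l))
  sphere_union : ⋃ j, range (sphere j) = handles.outerBoundary

namespace HandlebodyData

variable {S : Type*} [TopologicalSpace S] {n : ℕ} {Z : Fin n → Set S} (D : HandlebodyData Z)

/-- The gluing of a 3-ball to each of the boundary spheres. -/
inductive Rel : D.handles.Space ⊕ (Fin D.numBalls × UnitBall) →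
    D.handles.Space ⊕ (Fin D.numBalls × UnitBall) → Prop
  | glue (j : Fin D.numBalls) (x : UnitSphere) :
      Rel (Sum.inr (j, UnitBall.ofSphere x)) (Sum.inl (D.sphere j x))

/-- The handlebody `V_Z`: 2-handles are attached to `S × [0, 1]` along the curves of `Z` in
`S × {1}`, and the resulting boundary spheres are capped off by 3-balls. -/
def Handlebody : Type _ := Quot D.Rel

instance : TopologicalSpace D.Handlebody := inferInstanceAs (TopologicalSpace (Quot D.Rel))

/-- The identification of `S` with the boundary `S × {0}` of the handlebody. -/
def boundary (x : S) : D.Handlebody :=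
  Quot.mk D.Rel (Sum.inl (Quot.mk D.handles.Rel (Sum.inl (x, 0))))

/-- The curve `c` in `S = ∂V_Z` bounds a properly embedded disk in the handlebody. -/
def BoundsDisk (c : Set S) : Prop :=
  ∃ f : UnitDisk → D.Handlebody, IsEmbedding f ∧ f '' UnitDisk.circle = D.boundary '' c ∧
    f ⁻¹' range D.boundary = UnitDisk.circle

end HandlebodyData

/-- The disk set `K_Z` of `V_Z`: the isotopy classes of essential simple closed curves in `S` that
bound embedded disks in `V_Z`. (Different choices in the construction of `V_Z` give handlebodies
that are homeomorphic by a homeomorphism fixing the boundary, so the choice does not matter.) -/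
def diskSet {S : Type*} [TopologicalSpace S] {n : ℕ} (Z : Fin n → Set S) : Set (CurveVertex S) :=
  {v | ∃ c : EssentialCurve S, c.toVertex = v ∧ ∃ D : HandlebodyData Z, D.BoundsDisk c.1}

/-! A Dehn twist `τ` about `γ` can be supported in an arbitrarily thin annulus around `γ`, so it
fixes every vertex at distance at most `1` from `[γ]`. If `d(K_P, [γ]) ≤ d + 1`, a shortest path
from `K_P` to `[γ]` passes through such a vertex `w` with `d(K_P, w) ≤ d`. Since `τ ^ k` acts on
the curve complex by automorphisms, carries `K_P` to the disk set of `τ ^ k (P)` and fixes `w`, the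
path from `K_P` to `w` followed by the reverse of its image has length at most `2 d`.
-/

open scoped Pointwise

/-! ### Handlebodies and homeomorphisms of the boundary -/

/-- The image of an annular neighbourhood under a homeomorphism. -/
def AnnularNbhd.map {S : Type*} [TopologicalSpace S] {c : Set S} (N : AnnularNbhd c)
    (h : S ≃ₜ S) : AnnularNbhd (h '' c) where
  φ := h ∘ N.φ
  isEmbedding := h.isEmbedding.comp N.isEmbedding
  isOpen_interior := by
    rw [image_comp]
    exact h.isOpenMap _ N.isOpen_interior
  core := by rw [image_comp, N.core]

namespace HandleData

variable {S : Type*} [TopologicalSpace S] {n : ℕ} {Z : Fin n → Set S} (D : HandleData Z)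

/-- The image of a system of attaching annuli under a homeomorphism. -/
def map (h : S ≃ₜ S) : HandleData (fun i => h '' Z i) where
  nbhd i := (D.nbhd i).map h
  disjoint i j hij := by
    change Disjoint (range (h ∘ (D.nbhd i).φ)) (range (h ∘ (D.nbhd j).φ))
    rw [range_comp, range_comp, disjoint_image_iff h.injective]
    exact D.disjoint hij

/-- The homeomorphism induced by `h` between the pieces from which `D.Space` and `(D.map h).Space`
are glued: `h` on the levels of `S × [0, 1]`, the identity on the handles. -/
noncomputable def piecesHomeomorph (n : ℕ) (h : S ≃ₜ S) :
    (S × unitInterval) ⊕ (Fin n × UnitDisk × unitInterval) ≃ₜ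
      (S × unitInterval) ⊕ (Fin n × UnitDisk × unitInterval) :=
  (h.prodCongr (Homeomorph.refl _)).sumCongr (Homeomorph.refl _)

theorem rel_iff {a b : (S × unitInterval) ⊕ (Fin n × UnitDisk × unitInterval)} :
    D.Rel a b ↔ ∃ i z t, a = Sum.inr (i, UnitDisk.ofCircle z, t) ∧
      b = Sum.inl ((D.nbhd i).φ (z, t), 1) :=
  ⟨fun ⟨i, z, t⟩ => ⟨i, z, t, rfl, rfl⟩, fun ⟨i, z, t, ha, hb⟩ => ha ▸ hb ▸ .glue i z t⟩

theorem rel_map_iff (h : S ≃ₜ S) (a b : (S × unitInterval) ⊕ (Fin n × UnitDisk × unitInterval)) :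
    D.Rel a b ↔ (D.map h).Rel (piecesHomeomorph n h a) (piecesHomeomorph n h b) := by
  simp only [rel_iff]
  exact exists_congr fun i => exists_congr fun z => exists_congr fun t => and_congr
    (piecesHomeomorph n h).injective.eq_iff.symm (piecesHomeomorph n h).injective.eq_iff.symm

/-- The homeomorphism of the manifolds with 2-handles induced by a homeomorphism of the surface. -/
noncomputable def spaceHomeomorph (h : S ≃ₜ S) : D.Space ≃ₜ (D.map h).Space :=
  Homeomorph.Quot.congr (piecesHomeomorph n h) (D.rel_map_iff h)

theorem apply_mem_image_interior_map_iff (h : S ≃ₜ S) (i : Fin n) (x : S) :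
    h x ∈ ((D.map h).nbhd i).φ '' Annulus.interior ↔ x ∈ (D.nbhd i).φ '' Annulus.interior := by
  change h x ∈ (h ∘ (D.nbhd i).φ) '' Annulus.interior ↔ _
  rw [image_comp, h.injective.mem_set_image]

theorem image_outerBoundary (h : S ≃ₜ S) :
    D.spaceHomeomorph h '' D.outerBoundary = (D.map h).outerBoundary := by
  apply Subset.antisymm
  · rintro _ ⟨_, ⟨x, hx, rfl⟩ | ⟨i, z, t, ht, rfl⟩, rfl⟩
    · exact Or.inl ⟨h x, fun i => (D.apply_mem_image_interior_map_iff h i x).not.2 (hx i), rfl⟩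
    · exact Or.inr ⟨i, z, t, ht, rfl⟩
  · rintro _ (⟨y, hy, rfl⟩ | ⟨i, z, t, ht, rfl⟩)
    · obtain ⟨x, rfl⟩ := h.surjective y
      exact ⟨_, Or.inl ⟨x, fun i => (D.apply_mem_image_interior_map_iff h i x).not.1 (hy i), rfl⟩,
        rfl⟩
    · exact ⟨_, Or.inr ⟨i, z, t, ht, rfl⟩, rfl⟩

end HandleData

namespace HandlebodyData

variable {S : Type*} [TopologicalSpace S] {n : ℕ} {Z : Fin n → Set S} (D : HandlebodyData Z)

/-- The image of handlebody data under a homeomorphism of the surface. -/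
noncomputable def map (h : S ≃ₜ S) : HandlebodyData (fun i => h '' Z i) where
  handles := D.handles.map h
  numBalls := D.numBalls
  sphere j := D.handles.spaceHomeomorph h ∘ D.sphere j
  sphere_isEmbedding j := (D.handles.spaceHomeomorph h).isEmbedding.comp (D.sphere_isEmbedding j)
  sphere_disjoint i j hij := by
    dsimp only
    rw [range_comp, range_comp, disjoint_image_iff (D.handles.spaceHomeomorph h).injective]
    exact D.sphere_disjoint hij
  sphere_union := by
    simp_rw [range_comp]
    rw [← image_iUnion, D.sphere_union, D.handles.image_outerBoundary]

/-- The homeomorphism induced by `h` between the pieces from which `D.Handlebody` and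
`(D.map h).Handlebody` are glued: the identity on the balls. -/
noncomputable def piecesHomeomorph (h : S ≃ₜ S) :
    D.handles.Space ⊕ (Fin D.numBalls × UnitBall) ≃ₜ
      (D.map h).handles.Space ⊕ (Fin (D.map h).numBalls × UnitBall) :=
  (D.handles.spaceHomeomorph h).sumCongr (Homeomorph.refl (Fin D.numBalls × UnitBall))

theorem rel_iff {a b : D.handles.Space ⊕ (Fin D.numBalls × UnitBall)} :
    D.Rel a b ↔ ∃ j x, a = Sum.inr (j, UnitBall.ofSphere x) ∧ b = Sum.inl (D.sphere j x) :=
  ⟨fun ⟨j, x⟩ => ⟨j, x, rfl, rfl⟩, fun ⟨j, x, ha, hb⟩ => ha ▸ hb ▸ .glue j x⟩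

theorem rel_map_iff (h : S ≃ₜ S) (a b : D.handles.Space ⊕ (Fin D.numBalls × UnitBall)) :
    D.Rel a b ↔ (D.map h).Rel (D.piecesHomeomorph h a) (D.piecesHomeomorph h b) := by
  simp only [rel_iff]
  exact exists_congr fun j => exists_congr fun x => and_congr
    (D.piecesHomeomorph h).injective.eq_iff.symm (D.piecesHomeomorph h).injective.eq_iff.symm

/-- The homeomorphism of handlebodies induced by a homeomorphism of the surface. -/
noncomputable def handlebodyHomeomorph (h : S ≃ₜ S) : D.Handlebody ≃ₜ (D.map h).Handlebody :=
  Homeomorph.Quot.congr (D.piecesHomeomorph h) (D.rel_map_iff h)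

theorem boundary_map_comp (h : S ≃ₜ S) :
    (D.map h).boundary ∘ h = D.handlebodyHomeomorph h ∘ D.boundary := rfl

theorem BoundsDisk.map {D : HandlebodyData Z} {c : Set S} (hc : D.BoundsDisk c) (h : S ≃ₜ S) :
    (D.map h).BoundsDisk (h '' c) := by
  obtain ⟨f, hf, hfc, hfb⟩ := hc
  refine ⟨D.handlebodyHomeomorph h ∘ f, (D.handlebodyHomeomorph h).isEmbedding.comp hf, ?_, ?_⟩
  · rw [image_comp, hfc, ← image_comp, ← image_comp, boundary_map_comp]
  · rw [← h.surjective.range_comp, boundary_map_comp, range_comp, preimage_comp,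
      preimage_image_eq _ (D.handlebodyHomeomorph h).injective, hfb]

end HandlebodyData

/-! ### The action of homeomorphisms on the curve complex -/

section Isotopy

variable {S : Type*} [TopologicalSpace S] {f g : S ≃ₜ S} {c c' : Set S}

theorem IsotopicHomeo.precomp (hfg : IsotopicHomeo f g) (e : S ≃ₜ S) :
    IsotopicHomeo (e.trans f) (e.trans g) := by
  obtain ⟨H, hH, rfl, rfl⟩ := hfg
  exact ⟨fun t => e.trans (H t),
    hH.comp (f := fun p : unitInterval × S => (p.1, e p.2)) (by fun_prop), rfl, rfl⟩

theorem IsotopicHomeo.postcomp (hfg : IsotopicHomeo f g) (e : S ≃ₜ S) :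
    IsotopicHomeo (f.trans e) (g.trans e) := by
  obtain ⟨H, hH, rfl, rfl⟩ := hfg
  exact ⟨fun t => (H t).trans e, e.continuous.comp hH, rfl, rfl⟩

theorem IsotopicHomeo.isotopicSets_image (hfg : IsotopicHomeo f g) (c : Set S) :
    IsotopicSets (f '' c) (g '' c) := by
  refine ⟨f.symm.trans g, ?_, ?_⟩
  · simpa only [Homeomorph.symm_trans_self] using hfg.precomp f.symm
  · simp only [image_image, Homeomorph.trans_apply, Homeomorph.symm_apply_apply]

theorem IsotopicSets.image (hc : IsotopicSets c c') (e : S ≃ₜ S) :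
    IsotopicSets (e '' c) (e '' c') := by
  obtain ⟨f, hf, rfl⟩ := hc
  rw [← image_comp]
  exact (hf.postcomp e).isotopicSets_image c

theorem IsEssentialCurve.image (hc : IsEssentialCurve c) (h : S ≃ₜ S) :
    IsEssentialCurve (h '' c) := by
  obtain ⟨f, hf, rfl, hf_ess⟩ := hc
  refine ⟨(h : C(S, S)).comp f, h.isEmbedding.comp hf, range_comp h f, fun hhf => hf_ess ?_⟩
  convert hhf.comp_right (h.symm : C(S, S))
  ext z
  simp

end Isotopy

section Action

variable {S : Type*} [TopologicalSpace S]

instance : MulAction (S ≃ₜ S) (EssentialCurve S) where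
  smul h c := ⟨h '' c.1, c.2.image h⟩
  one_smul c := Subtype.ext (image_id c.1)
  mul_smul f g c := Subtype.ext (image_comp f g c.1)

instance : MulAction (S ≃ₜ S) (CurveVertex S) where
  smul h := Quotient.map (h • ·) fun _ _ hc => IsotopicSets.image hc h
  one_smul := Quotient.ind fun c => congrArg EssentialCurve.toVertex (one_smul _ c)
  mul_smul f g := Quotient.ind fun c => congrArg EssentialCurve.toVertex (mul_smul f g c)

theorem EssentialCurve.disjoint_smul_iff (h : S ≃ₜ S) {a b : EssentialCurve S} :
    Disjoint (h • a).1 (h • b).1 ↔ Disjoint a.1 b.1 :=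
  disjoint_image_iff h.injective

theorem curveGraph_adj_smul (h : S ≃ₜ S) {v w : CurveVertex S} (hvw : (curveGraph S).Adj v w) :
    (curveGraph S).Adj (h • v) (h • w) := by
  obtain ⟨hne, a, b, rfl, rfl, hab⟩ := hvw
  exact ⟨(MulAction.injective h).ne hne, h • a, h • b, rfl, rfl,
    (EssentialCurve.disjoint_smul_iff h).2 hab⟩

theorem curveGraph_edist_smul_le (h : S ≃ₜ S) (v w : CurveVertex S) :
    (curveGraph S).edist (h • v) (h • w) ≤ (curveGraph S).edist v w :=
  le_iInf fun p => (p.map ⟨(h • ·), curveGraph_adj_smul h⟩).edist_le.trans_eq <| by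
    rw [SimpleGraph.Walk.length_map]

theorem exists_toVertex_eq_disjoint_of_adj {v : CurveVertex S} {c : EssentialCurve S}
    (hv : (curveGraph S).Adj v c.toVertex) :
    ∃ a : EssentialCurve S, a.toVertex = v ∧ Disjoint a.1 c.1 := by
  obtain ⟨-, a, b, rfl, hbc, hab⟩ := hv
  obtain ⟨f, hf, hfb⟩ : IsotopicSets b.1 c.1 := Quotient.exact hbc
  refine ⟨f • a, Quotient.sound (IsotopicSets.symm ⟨f, hf, rfl⟩), ?_⟩
  rw [← hfb]
  exact (EssentialCurve.disjoint_smul_iff f).2 hab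

theorem smul_diskSet_subset {n : ℕ} (h : S ≃ₜ S) (Z : Fin n → Set S) :
    h • diskSet Z ⊆ diskSet (fun i => h '' Z i) := by
  rintro _ ⟨_, ⟨c, rfl, D, hD⟩, rfl⟩
  exact ⟨h • c, rfl, D.map h, hD.map h⟩

theorem diskSet_image {n : ℕ} (h : S ≃ₜ S) (Z : Fin n → Set S) :
    diskSet (fun i => h '' Z i) = h • diskSet Z := by
  refine Subset.antisymm ?_ (smul_diskSet_subset h Z)
  have hZ : (fun i => (h⁻¹ : S ≃ₜ S) '' (h '' Z i)) = Z :=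
    funext fun i => by simp [image_image]
  simpa only [hZ, subset_smul_set_iff] using smul_diskSet_subset (h⁻¹) fun i => h '' Z i

end Action

/-! ### Distances in the curve complex -/

theorem exists_edist_le_and_edist_le_one {V : Type*} {G : SimpleGraph V} {u v : V} {d : ℕ}
    (huv : G.edist u v ≤ d + 1) : ∃ w, G.edist u w ≤ d ∧ G.edist w v ≤ 1 := by
  obtain ⟨p, hp⟩ := SimpleGraph.exists_walk_of_edist_ne_top (ne_top_of_le_ne_top (by simp) huv)
  rw [← hp] at huv
  norm_cast at huv
  refine ⟨p.getVert d, (p.take d).edist_le.trans ?_, (p.drop d).edist_le.trans ?_⟩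
  · rw [SimpleGraph.Walk.take_length]
    exact_mod_cast min_le_left _ _
  · rw [SimpleGraph.Walk.drop_length]
    exact_mod_cast Nat.sub_le_iff_le_add'.2 huv

section Distance

variable {S : Type*} [TopologicalSpace S] {A B : Set (CurveVertex S)} {u v w : CurveVertex S}

theorem curveDist_le_edist (hu : u ∈ A) (hv : v ∈ B) :
    curveDist A B ≤ (curveGraph S).edist u v :=
  iInf₂_le_of_le u hu (iInf₂_le v hv)

theorem curveDist_le_iff {d : ℕ∞} (hd : d ≠ ⊤) :
    curveDist A B ≤ d ↔ ∃ u ∈ A, ∃ v ∈ B, (curveGraph S).edist u v ≤ d := by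
  simp only [← ENat.lt_add_one_iff hd, curveDist, iInf_lt_iff, exists_prop]

theorem exists_edist_le_one_curveDist_le {d : ℕ} (hv : curveDist A {v} ≤ d + 1) :
    ∃ w, (curveGraph S).edist w v ≤ 1 ∧ curveDist A {w} ≤ d := by
  obtain ⟨u, hu, v', hv', huv⟩ := (curveDist_le_iff (by simp)).1 hv
  obtain ⟨w, huw, hwv⟩ := exists_edist_le_and_edist_le_one huv
  rw [mem_singleton_iff.1 hv'] at hwv
  exact ⟨w, hwv, (curveDist_le_edist hu (mem_singleton w)).trans huw⟩

theorem curveDist_smul_le_of_smul_eq {h : S ≃ₜ S} (hw : h • w = w) (A : Set (CurveVertex S)) :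
    curveDist A (h • A) ≤ 2 * curveDist A {w} := by
  rcases eq_or_ne (curveDist A {w}) ⊤ with htop | hfin
  · simp [htop]
  obtain ⟨u, hu, w, rfl, huw⟩ := (curveDist_le_iff hfin).1 le_rfl
  calc curveDist A (h • A)
      ≤ (curveGraph S).edist u (h • u) := curveDist_le_edist hu (smul_mem_smul_set hu)
    _ ≤ (curveGraph S).edist u w + (curveGraph S).edist w (h • u) := SimpleGraph.edist_triangle
    _ = (curveGraph S).edist u w + (curveGraph S).edist (h • u) (h • w) := by
        rw [hw, SimpleGraph.edist_comm (u := w)]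
    _ ≤ (curveGraph S).edist u w + (curveGraph S).edist u w := by
        gcongr
        exact curveGraph_edist_smul_le h u w
    _ ≤ 2 * curveDist A {w} := by
        rw [← two_mul]
        gcongr

end Distance

/-! ### Dehn twists and curves disjoint from the core -/

theorem exists_continuousMap_eq_zero_eq_one_of_notMem {X : Type*} [LinearOrder X]
    [TopologicalSpace X] [OrderTopology X] {L : Set X} (hL : IsClosed L) {m : X} (hm : m ∉ L) :
    ∃ u : C(X, ℝ), (∀ t ∈ L, t ≤ m → u t = 0) ∧ ∀ t ∈ L, m ≤ t → u t = 1 := by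
  have hdisj : Disjoint (L ∩ Iic m) (L ∩ Ici m) :=
    disjoint_left.2 fun _ h h' => hm (le_antisymm h.2 h'.2 ▸ h.1)
  obtain ⟨u, hu0, hu1, -⟩ := exists_continuous_zero_one_of_isClosed
    (hL.inter isClosed_Iic) (hL.inter isClosed_Ici) hdisj
  exact ⟨u, fun t ht htm => hu0 ⟨ht, htm⟩, fun t ht hmt => hu1 ⟨ht, hmt⟩⟩

namespace Annulus

/-- The shear `(θ, t) ↦ (θ + 2π u(t), t)` of the annulus, a twist with angle profile `u`. -/
noncomputable def shear (u : C(unitInterval, ℝ)) : Annulus ≃ₜ Annulus where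
  toFun a := (a.1 * Circle.exp (2 * Real.pi * u a.2), a.2)
  invFun a := (a.1 * (Circle.exp (2 * Real.pi * u a.2))⁻¹, a.2)
  left_inv a := by simp
  right_inv a := by simp
  continuous_toFun := by fun_prop
  continuous_invFun := by fun_prop

theorem shear_eq_self {u : C(unitInterval, ℝ)} {a : Annulus} (ha : u a.2 = 0 ∨ u a.2 = 1) :
    shear u a = a := by
  rcases ha with h | h <;> simp [shear, h]

theorem snd_eq_zero_or_one_of_notMem_interior {a : Annulus} (ha : a ∉ interior) :
    a.2 = 0 ∨ a.2 = 1 := by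
  by_contra! h
  exact ha ⟨unitInterval.pos_iff_ne_zero.2 h.1, unitInterval.lt_one_iff_ne_one.2 h.2⟩

theorem shear_of_notMem_interior {u : C(unitInterval, ℝ)} (h0 : u 0 = 0) (h1 : u 1 = 1)
    (a : Annulus) (ha : a ∉ interior) : shear u a = a :=
  shear_eq_self <| (snd_eq_zero_or_one_of_notMem_interior ha).imp
    (fun h => (congrArg u h).trans h0) fun h => (congrArg u h).trans h1

theorem twist_image_core : twist '' core = core := by
  rw [Homeomorph.image_eq_preimage_symm]
  rfl

end Annulus

namespace AnnularNbhd

variable {S : Type*} [TopologicalSpace S] [T2Space S] {c : Set S} (N : AnnularNbhd c)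

/-- The extension by the identity of a homeomorphism of the annulus that fixes the boundary circles
to a homeomorphism of the surface supported in an annular neighbourhood. -/
noncomputable def extendHomeomorph (e : Annulus ≃ₜ Annulus)
    (he : ∀ a, a ∉ Annulus.interior → e a = a) : S ≃ₜ S where
  toFun := Function.extend N.φ (N.φ ∘ e) id
  invFun := Function.extend N.φ (N.φ ∘ e.symm) id
  left_inv := N.extend_symm_extend e
  right_inv := N.extend_symm_extend e.symm
  continuous_toFun := N.continuous_extend e he
  continuous_invFun := N.continuous_extend _ fun a ha => by
    rw [Homeomorph.symm_apply_eq, he a ha]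

theorem extendHomeomorph_eq_self {e : Annulus ≃ₜ Annulus}
    (he : ∀ a, a ∉ Annulus.interior → e a = a) {x : S} (hx : ∀ a, N.φ a = x → e a = a) :
    N.extendHomeomorph e he x = x := by
  by_cases h : ∃ a, N.φ a = x
  · obtain ⟨a, rfl⟩ := h
    exact (N.extend_apply e a).trans (congrArg N.φ (hx a rfl))
  · exact Function.extend_apply' _ _ _ h

theorem continuous_extendHomeomorph_uncurry {T : Type*} [TopologicalSpace T]
    {e : T → Annulus ≃ₜ Annulus} (he : ∀ s a, a ∉ Annulus.interior → e s a = a)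
    (hcont : Continuous fun p : T × Annulus => e p.1 p.2) :
    Continuous fun p : T × S => N.extendHomeomorph (e p.1) (he p.1) p.2 := by
  have hE : IsClosedEmbedding (Prod.map id N.φ : T × Annulus → T × S) :=
    IsClosedEmbedding.id.prodMap (N.isEmbedding.continuous.isClosedEmbedding
      N.isEmbedding.injective)
  have hcover : range (Prod.map id N.φ : T × Annulus → T × S) ∪
      Prod.snd ⁻¹' (N.φ '' Annulus.interior)ᶜ = univ := by
    refine eq_univ_of_forall fun ⟨s, x⟩ => (em (x ∈ N.φ '' Annulus.interior)).imp ?_ id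
    rintro ⟨a, -, rfl⟩
    exact ⟨(s, a), rfl⟩
  rw [← continuousOn_univ, ← hcover]
  refine ContinuousOn.union_of_isClosed ?_ ?_ hE.isClosed_range
    (N.isOpen_interior.isClosed_compl.preimage continuous_snd)
  · rw [← image_univ, hE.isInducing.continuousOn_image_iff, continuousOn_univ]
    exact (N.isEmbedding.continuous.comp hcont).congr fun p => (N.extend_apply (e p.1) p.2).symm
  · exact continuousOn_snd.congr fun p hp => N.extend_apply_of_not_mem (e p.1) (he p.1) hp

/-- The homeomorphism of the surface that shears an annular neighbourhood with angle profile `u`.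
The Dehn twist is the case where `u` is the inclusion of `[0, 1]` in `ℝ`. -/
noncomputable def shear (u : C(unitInterval, ℝ)) (h0 : u 0 = 0) (h1 : u 1 = 1) : S ≃ₜ S :=
  N.extendHomeomorph (Annulus.shear u) (Annulus.shear_of_notMem_interior h0 h1)

theorem isotopicHomeo_shear_shear {u v : C(unitInterval, ℝ)} (hu0 : u 0 = 0) (hu1 : u 1 = 1)
    (hv0 : v 0 = 0) (hv1 : v 1 = 1) :
    IsotopicHomeo (N.shear u hu0 hu1) (N.shear v hv0 hv1) := by
  let w (s : unitInterval) : C(unitInterval, ℝ) := (1 - (s : ℝ)) • u + (s : ℝ) • v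
  have hw0 (s : unitInterval) : w s 0 = 0 := by simp [w, hu0, hv0]
  have hw1 (s : unitInterval) : w s 1 = 1 := by simp [w, hu1, hv1]
  have hw_zero : w 0 = u := by simp [w]
  have hw_one : w 1 = v := by simp [w]
  refine ⟨fun s => N.shear (w s) (hw0 s) (hw1 s), ?_, by simp only [hw_zero], by simp only [hw_one]⟩
  refine N.continuous_extendHomeomorph_uncurry
    (fun s => Annulus.shear_of_notMem_interior (hw0 s) (hw1 s)) ?_
  change Continuous fun p : unitInterval × Annulus => (p.2.1 * Circle.exp
    (2 * Real.pi * ((1 - (p.1 : ℝ)) * u p.2.2 + p.1 * v p.2.2)), p.2.2)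
  fun_prop

theorem isotopicHomeo_dehnTwist_shear {u : C(unitInterval, ℝ)} (h0 : u 0 = 0) (h1 : u 1 = 1) :
    IsotopicHomeo N.dehnTwist (N.shear u h0 h1) :=
  N.isotopicHomeo_shear_shear (u := ⟨Subtype.val, continuous_subtype_val⟩) rfl rfl h0 h1

theorem exists_shear_eqOn_id {K : Set S} (hK : IsClosed K) (hKc : Disjoint K c) :
    ∃ (u : C(unitInterval, ℝ)) (h0 : u 0 = 0) (h1 : u 1 = 1), EqOn (N.shear u h0 h1) id K := by
  let m : unitInterval := ⟨1 / 2, by norm_num, by norm_num⟩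
  let L : Set unitInterval := Prod.snd '' (N.φ ⁻¹' K)
  have hL : IsClosed L :=
    ((hK.preimage N.isEmbedding.continuous).isCompact.image continuous_snd).isClosed
  have hmL : m ∉ L := by
    rintro ⟨a, haK, ham⟩
    have hac : N.φ a ∈ c := N.core.subset (mem_image_of_mem N.φ (congrArg Subtype.val ham))
    exact disjoint_left.1 hKc haK hac
  have hm0 : 0 < m := unitInterval.coe_pos.1 (by norm_num [m])
  have hm1 : m < 1 := unitInterval.coe_lt_one.1 (by norm_num [m])
  obtain ⟨u, hu0, hu1⟩ := exists_continuousMap_eq_zero_eq_one_of_notMem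
    (((toFinite {0, 1}).isClosed).union hL) (m := m) (by simp [hm0.ne', hm1.ne, hmL])
  refine ⟨u, hu0 0 (by simp) hm0.le, hu1 1 (by simp) hm1.le, fun x hx => ?_⟩
  refine N.extendHomeomorph_eq_self _ fun a hax => Annulus.shear_eq_self ?_
  have haL : a.2 ∈ {0, 1} ∪ L := .inr ⟨a, by rwa [mem_preimage, hax], rfl⟩
  exact (le_total a.2 m).imp (hu0 _ haL) (hu1 _ haL)

theorem isotopicSets_dehnTwist_image {K : Set S} (hK : IsClosed K) (hKc : Disjoint K c) :
    IsotopicSets (N.dehnTwist '' K) K := by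
  obtain ⟨u, h0, h1, hfix⟩ := N.exists_shear_eqOn_id hK hKc
  simpa only [hfix.image_eq, image_id] using
    (N.isotopicHomeo_dehnTwist_shear h0 h1).isotopicSets_image K

theorem dehnTwist_image_core : N.dehnTwist '' c = c := by
  have hcomm : N.dehnTwist ∘ N.φ = N.φ ∘ Annulus.twist := funext (N.extend_apply Annulus.twist)
  calc N.dehnTwist '' c = N.dehnTwist '' (N.φ '' Annulus.core) := by rw [N.core]
    _ = N.φ '' (Annulus.twist '' Annulus.core) := by rw [← image_comp, hcomm, image_comp]
    _ = c := by rw [Annulus.twist_image_core, N.core]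

end AnnularNbhd

section DehnTwist

variable {S : Type*} [TopologicalSpace S] [T2Space S] {γ : EssentialCurve S} {τ : S ≃ₜ S}

theorem EssentialCurve.isClosed (a : EssentialCurve S) : IsClosed a.1 := by
  obtain ⟨f, -, hf, -⟩ := a.2
  exact hf ▸ (isCompact_range f.continuous).isClosed

theorem IsDehnTwist.smul_eq_of_edist_le_one (hτ : IsDehnTwist γ.1 τ) {v : CurveVertex S}
    (hv : (curveGraph S).edist v γ.toVertex ≤ 1) : τ • v = v := by
  obtain ⟨N, hN⟩ := hτ
  rcases SimpleGraph.edist_le_one_iff_adj_or_eq.1 hv with hadj | rfl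
  · obtain ⟨a, rfl, haγ⟩ := exists_toVertex_eq_disjoint_of_adj hadj
    exact Quotient.sound
      ((hN.isotopicSets_image a.1).symm.trans (N.isotopicSets_dehnTwist_image a.isClosed haγ))
  · have hγ := (hN.isotopicSets_image γ.1).symm
    rw [N.dehnTwist_image_core] at hγ
    exact Quotient.sound hγ

theorem mainTheorem8_general {n : ℕ} (Z : Fin n → Set S) (hτ : IsDehnTwist γ.1 τ) {d : ℕ}
    (hdist : curveDist (diskSet Z) {γ.toVertex} ≤ d + 1) (k : ℤ) :
    curveDist (diskSet Z) (diskSet (fun i => (τ ^ k) '' Z i)) ≤ 2 * d := by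
  obtain ⟨w, hwγ, hw⟩ := exists_edist_le_one_curveDist_le hdist
  have hfix : τ ^ k • w = w :=
    MulAction.mem_fixedBy_zpow (hτ.smul_eq_of_edist_le_one hwγ) k
  rw [diskSet_image]
  exact (curveDist_smul_le_of_smul_eq hfix _).trans (by gcongr)

end DehnTwist

theorem mainTheorem8 {S : Type*} [TopologicalSpace S] [T2Space S] [CompactSpace S]
    [ConnectedSpace S] [ChartedSpace (EuclideanSpace ℝ (Fin 2)) S]
    (hS : IsOrientableSurface S) (g : ℕ) (hg : 2 ≤ g) (hgenus : HasGenus S g)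
    (P : Fin (3 * g - 3) → Set S) (hP : IsPantsDecomposition g P)
    (γ : EssentialCurve S) (τ : S ≃ₜ S) (hτ : IsDehnTwist γ.1 τ)
    (d : ℕ) (hd : 1 ≤ d) (hdist : curveDist (diskSet P) {γ.toVertex} = (d : ℕ∞)) (k : ℤ) :
    curveDist (diskSet P) (diskSet (fun i => (τ ^ k) '' P i)) ≤ ((2 * d - 2 : ℕ) : ℕ∞) := by
  obtain ⟨d, rfl⟩ := Nat.exists_eq_add_of_le' hd
  simpa [mul_add] using mainTheorem8_general P hτ (by simpa using hdist.le) k
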